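/- Let $G$ be a locally compact Hausdorff group, $H$ a closed subgroup of $G$ and $L$ a closed subgroup of $H$ such that $\Delta_H|_L=\Delta_L$, where $\Delta_G,\Delta_H,\Delta_L$ denote the modular functions. A Radon measure is a positive Borel measure that is finite on compact sets, outer regular on Borel sets and inner regular (by compact sets) on open sets. Then the following hold. 1. There exist nonzero $G$-invariant Radon measures $\mu$ on $G/H$ and $\nu$ on $G/L$ if and only if $\Delta_G|_H=\Delta_H$. 2. Such measures are unique up to a constant factor: any two nonzero $G$-invariant Radon measures on $G/H$ are positive multiples of each other, and likewise on $G/L$. 3. There is a nonzero $H$-invariant Radon measure on $H/L$. Let $\eta$ be any such measure, and for $f\in C_c(G/L)$ (complex-valued continuous functions with compact support) put $$R_{L,H}f(xH)=\int_{H/L} f(xhL)\,d\eta(hL)\qquad(x\in G),$$ which does not depend on the representative $x$ of $xH$. Then $R_{L,H}f\in C_c(G/H)$ for every $f\in C_c(G/L)$. Moreover, if $\mu$ and $\nu$ are nonzero $G$-invariant Radon measures on $G/H$ and $G/L$, then after multiplying $\nu$ by a suitable positive constant (independent of $f$) one has, for all $f\in C_c(G/L)$, $$\int_{G/L} f(xL)\,d\nu(xL)=\int_{G/H}R_{L,H}f(xH)\,d\mu(xH)=\int_{G/H}\int_{H/L}f(xhL)\,d\eta(hL)\,d\mu(xH).$$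 -/

import Mathlib

open MeasureTheory
open scoped NNReal CompactlySupported

/-- A closed subgroup of a locally compact group is locally compact. -/
instance closedSubgroup_locallyCompactSpace {G : Type*} [Group G] [TopologicalSpace G]
    [LocallyCompactSpace G] (H : Subgroup G) [hH : IsClosed (H : Set G)] :
    LocallyCompactSpace H :=
  hH.isClosedEmbedding_subtypeVal.locallyCompactSpace

/-- `μ` is a nonzero Radon measure on the `Γ`-space `X`, invariant under the action of `Γ`.
Radon means: finite on compact sets, outer regular on Borel sets and inner regular with respect
to compact sets on open sets. -/
structure IsInvariantRadonMeasure (Γ : Type*) {X : Type*} [Group Γ] [MulAction Γ X]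
    [TopologicalSpace X] [MeasurableSpace X] (μ : Measure X) : Prop where
  regular : μ.Regular
  invariant : SMulInvariantMeasure Γ X μ
  ne_zero : μ ≠ 0

section RadonTransform

variable {G : Type*} [Group G] {H L : Subgroup G}

/-- For `x : G`, the map `H / L → G / L`, `hL ↦ x h L`. -/
def cosetTranslate (H L : Subgroup G) (x : G) : H ⧸ L.subgroupOf H → G ⧸ L :=
  Quotient.map' (fun h : H => x * (h : G)) (by
    intro a b hab
    rw [QuotientGroup.leftRel_apply] at hab ⊢
    simpa [Subgroup.mem_subgroupOf, mul_assoc] using hab)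

theorem cosetTranslate_mk (x : G) (h : H) :
    cosetTranslate H L x (QuotientGroup.mk h) = QuotientGroup.mk (x * (h : G)) := rfl

theorem cosetTranslate_mul (x : G) (h : H) (t : H ⧸ L.subgroupOf H) :
    cosetTranslate H L (x * (h : G)) t = cosetTranslate H L x (h • t) := by
  induction t using QuotientGroup.induction_on with
  | H k => exact congrArg (QuotientGroup.mk (s := L)) (mul_assoc x (h : G) (k : G))

/-- The transform `R_{L,H} f (xH) = ∫_{H/L} f(xhL) dη(hL)`, a function on `G / H`; it does not
depend on the representative `x` because `η` is `H`-invariant. -/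
noncomputable def radonTransform [TopologicalSpace G] [IsTopologicalGroup G]
    [MeasurableSpace (H ⧸ L.subgroupOf H)] [BorelSpace (H ⧸ L.subgroupOf H)]
    (η : Measure (H ⧸ L.subgroupOf H)) (hη : SMulInvariantMeasure H (H ⧸ L.subgroupOf H) η)
    (f : G ⧸ L → ℂ) : G ⧸ H → ℂ :=
  Quotient.lift (fun x : G => ∫ t, f (cosetTranslate H L x t) ∂η) (by
    intro x y hxy
    have hxy' : x⁻¹ * y ∈ H := QuotientGroup.leftRel_apply.mp hxy
    have key : ∀ t, cosetTranslate H L y t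
        = cosetTranslate H L x ((⟨x⁻¹ * y, hxy'⟩ : H) • t) := by
      intro t
      rw [← cosetTranslate_mul]
      simp
    simp only [key]
    exact (integral_smul_eq_self (fun t => f (cosetTranslate H L x t))).symm)

theorem radonTransform_mk [TopologicalSpace G] [IsTopologicalGroup G]
    [MeasurableSpace (H ⧸ L.subgroupOf H)] [BorelSpace (H ⧸ L.subgroupOf H)]
    (η : Measure (H ⧸ L.subgroupOf H)) (hη : SMulInvariantMeasure H (H ⧸ L.subgroupOf H) η)
    (f : G ⧸ L → ℂ) (x : G) :
    radonTransform η hη f (QuotientGroup.mk x) = ∫ t, f (cosetTranslate H L x t) ∂η := rfl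

end RadonTransform

/-! Write f^♭(xH) = ∫_H f(xh) dh (`fiberIntegral`). This maps C_c(G) onto C_c(G/H), so measures on
G/H can be compared with Haar measure on G. If μ is invariant, f ↦ ∫ f^♭ dμ is a positive
left-invariant functional, hence a positive multiple of the Haar integral (Weil's formula).
Surjectivity then gives uniqueness, and right translation by h ∈ H forces Δ_G(h) = Δ_H(h).
Conversely, if Δ_G = Δ_H on H, a Fubini argument (`integral_mul_fiberIntegral_comm`) shows that ∫ f
depends only on f^♭, and Riesz representation turns f^♭ ↦ ∫ f into an invariant measure.

For L ≤ H ≤ G, Weil's formula on H/L shows that R_{L,H} sends the fiber integral of g along L to a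
constant times its fiber integral along H. Hence R_{L,H} preserves continuity and compact support,
and both sides of the integral formula are multiples of ∫_G g. -/

/-! ### Modular characters and Haar integrals -/

section ModularCharacter

open Measure

variable {G : Type*} [Group G] [TopologicalSpace G] [IsTopologicalGroup G] [LocallyCompactSpace G]

theorem coe_modularCharacter_inv (g : G) :
    (modularCharacter g⁻¹ : ℝ) = (modularCharacter g : ℝ)⁻¹ := by
  refine eq_inv_of_mul_eq_one_left ?_
  rw [← NNReal.coe_mul, ← map_mul, inv_mul_cancel, map_one, NNReal.coe_one]

variable [MeasurableSpace G] [BorelSpace G]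

omit [LocallyCompactSpace G] in
theorem integral_measure_inv {E : Type*} [NormedAddCommGroup E] [NormedSpace ℝ E] (μ : Measure G)
    (F : G → E) : ∫ y, F y ∂μ.inv = ∫ y, F y⁻¹ ∂μ :=
  (MeasurableEquiv.inv G).measurableEmbedding.integral_map _

/-- This fixes the convention: `modularCharacter` is the inverse of the function Δ with ∫ f(xg) dx =
Δ(g⁻¹) ∫ f. Equalities of modular functions are unaffected. -/
theorem integral_mul_right_eq_modularCharacter_mul (μ : Measure G) [μ.IsHaarMeasure]
    {f : G → ℝ} (hf : Continuous f) (hfc : HasCompactSupport f) (g : G) :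
    ∫ x, f (x * g) ∂μ = modularCharacter g * ∫ x, f x ∂μ := by
  rw [← integral_map (φ := (· * g)) (by fun_prop) hf.aestronglyMeasurable,
    integral_isMulLeftInvariant_eq_smul_of_hasCompactSupport (map (· * g) μ) μ hf hfc,
    integral_smul_nnreal_measure, ← modularCharacterFun_eq_haarScalarFactor μ g]
  rfl

theorem exists_integral_pos (μ : Measure G) [μ.IsHaarMeasure] :
    ∃ f : C_c(G, ℝ), 0 ≤ f ∧ 0 < ∫ x, f x ∂μ := by
  obtain ⟨f, hfc, hf0, hf1⟩ := exists_continuous_nonneg_pos (1 : G)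
  exact ⟨⟨f, hfc⟩, hf0,
    f.continuous.integral_pos_of_hasCompactSupport_nonneg_nonzero hfc hf0 hf1⟩

theorem continuous_modularCharacter :
    Continuous fun g : G ↦ (modularCharacter g : ℝ) := by
  let μ : Measure G := haar
  obtain ⟨f, -, hf⟩ := exists_integral_pos μ
  -- Passing to μ.inv puts ∫ f(xg) dx in convolution form, which is continuous in g.
  have key : (fun g : G ↦ (modularCharacter g : ℝ)) =
      fun g ↦ (∫ y, f (y⁻¹ * g) ∂μ.inv) / ∫ x, f x ∂μ := by
    ext g
    rw [integral_measure_inv, eq_div_iff hf.ne',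
      ← integral_mul_right_eq_modularCharacter_mul μ (map_continuous f) f.hasCompactSupport]
    simp
  rw [key]
  exact (continuous_integral_apply_inv_mul f.continuous f.hasCompactSupport).div_const _

theorem integral_modularCharacter_mul_comp_inv (μ : Measure G) [μ.IsHaarMeasure]
    {f : G → ℝ} (hf : Continuous f) (hfc : HasCompactSupport f) :
    ∫ x, modularCharacter x * f x⁻¹ ∂μ = ∫ x, f x ∂μ := by
  obtain ⟨g, hgc, hg0, hg1⟩ := exists_continuous_nonneg_pos (1 : G)
  have hg : 0 < ∫ x, g x ∂μ :=
    g.continuous.integral_pos_of_hasCompactSupport_nonneg_nonzero hgc hg0 hg1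
  rw [integral_isMulLeftInvariant_isMulRightInvariant_combo (μ := μ) (ν := μ.inv) hf hfc
    g.continuous hgc hg0 hg1, integral_measure_inv, ← integral_mul_const]
  congr 1 with x
  rw [integral_measure_inv]
  simp only [inv_inv]
  rw [integral_mul_right_eq_modularCharacter_mul μ g.continuous hgc, mul_inv,
    coe_modularCharacter_inv, inv_inv]
  field_simp

theorem modularCharacter_continuousMulEquiv {G' : Type*} [Group G'] [TopologicalSpace G']
    [IsTopologicalGroup G'] [LocallyCompactSpace G'] (e : G ≃ₜ* G') (g : G) :
    modularCharacter (e g) = modularCharacter g := by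
  borelize G'
  let μ : Measure G := haar
  obtain ⟨f, -, hf⟩ := exists_integral_pos (map e μ)
  have hint (F : G' → ℝ) : ∫ y, F y ∂map e μ = ∫ x, F (e x) ∂μ :=
    e.toHomeomorph.measurableEmbedding.integral_map F
  have h1 := integral_mul_right_eq_modularCharacter_mul (map e μ) f.continuous
    f.hasCompactSupport (e g)
  have h2 := integral_mul_right_eq_modularCharacter_mul μ (f := f ∘ e)
    (f.continuous.comp e.continuous) (f.hasCompactSupport.comp_homeomorph e.toHomeomorph) g
  rw [hint] at h1 hf
  simp only [← map_mul, hint] at h1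
  simp only [Function.comp_apply] at h2
  exact NNReal.coe_injective (mul_right_cancel₀ hf.ne' (h1.symm.trans h2))

end ModularCharacter

/-! ### Integration along the cosets of H -/

section FiberIntegral

open Topology Pointwise

variable {G : Type*} [Group G] [TopologicalSpace G] [IsTopologicalGroup G]
  {H : Subgroup G} [IsClosed (H : Set G)]
  {E : Type*} [NormedAddCommGroup E] [NormedSpace ℝ E]

omit [IsTopologicalGroup G] in
theorem Subgroup.isClosedEmbedding_subtype_of_isClosed : IsClosedEmbedding (H.subtype : H → G) :=
  (inferInstance : IsClosed (H : Set G)).isClosedEmbedding_subtypeVal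

/-- The restriction `h ↦ f (x h)` to `H` of a left translate of `f`. -/
noncomputable def fiberRestrict (H : Subgroup G) [IsClosed (H : Set G)] (f : C_c(G, E)) (x : G) :
    C_c(H, E) :=
  f.pullback_monoidHom (φ := H.subtype) Subgroup.isClosedEmbedding_subtype_of_isClosed x

omit [NormedSpace ℝ E] in
@[simp] theorem fiberRestrict_apply (f : C_c(G, E)) (x : G) (h : H) :
    fiberRestrict H f x h = f (x * h) := rfl

variable [LocallyCompactSpace G]

omit [IsClosed (H : Set G)] in
theorem QuotientGroup.exists_isCompact_subset_image_mk (H : Subgroup G) {C : Set (G ⧸ H)}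
    (hC : IsCompact C) :
    ∃ K : Set G, IsCompact K ∧ C ⊆ (QuotientGroup.mk : G → G ⧸ H) '' K := by
  refine hC.induction_on ⟨∅, isCompact_empty, by simp⟩
    (fun s t hst ⟨K, hK, h⟩ ↦ ⟨K, hK, hst.trans h⟩)
    (fun s t ⟨K, hK, h⟩ ⟨K', hK', h'⟩ ↦ ⟨K ∪ K', hK.union hK', ?_⟩) (fun z _ ↦ ?_)
  · rw [Set.image_union]
    exact Set.union_subset_union h h'
  · obtain ⟨x, rfl⟩ := QuotientGroup.mk_surjective z
    obtain ⟨K, hK, hx⟩ := exists_compact_mem_nhds x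
    exact ⟨_, mem_nhdsWithin_of_mem_nhds
      (QuotientGroup.isOpenQuotientMap_mk.isOpenMap.image_mem_nhds hx), K, hK, subset_rfl⟩

variable [MeasurableSpace G] [BorelSpace G] (m : Measure H) [m.IsHaarMeasure]

omit [IsClosed (H : Set G)] [LocallyCompactSpace G] in
theorem integral_fiber_mul (F : G → E) (x : G) (k : H) :
    ∫ h : H, F (x * k * h) ∂m = ∫ h : H, F (x * h) ∂m := by
  rw [← integral_mul_left_eq_self (fun h : H ↦ F (x * h)) k]
  simp [mul_assoc]

theorem continuous_integral_fiber (f : C_c(G, E)) :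
    Continuous fun x : G ↦ ∫ h : H, f (x * h) ∂m := by
  refine continuous_iff_continuousAt.2 fun x₀ ↦ ?_
  obtain ⟨t, ht, hx₀⟩ := exists_compact_mem_nhds x₀
  -- For x in t, only h in t⁻¹ · supp f contribute; H being closed, these lie in one compact set.
  have hk : IsCompact ((↑) ⁻¹' (t⁻¹ * tsupport f) : Set H) :=
    Subgroup.isClosedEmbedding_subtype_of_isClosed.isCompact_preimage
      (ht.inv.mul f.hasCompactSupport)
  refine (continuousOn_integral_of_compact_support hk (by fun_prop) ?_).continuousAt hx₀
  intro x h hx hh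
  contrapose! hh
  exact ⟨x⁻¹, Set.inv_mem_inv.mpr hx, x * h, subset_tsupport _ hh, by simp⟩

/-- For a Haar measure `m` on the closed subgroup `H`, the map `C_c(G) → C_c(G / H)` sending `f` to
`xH ↦ ∫_H f(xh) dm(h)`. -/
noncomputable def fiberIntegral : C_c(G, E) →ₗ[ℝ] C_c(G ⧸ H, E) where
  toFun f :=
    { toFun := Quotient.lift (fun x : G ↦ ∫ h : H, f (x * h) ∂m) (by
        intro x y hxy
        have hxy' : x⁻¹ * y ∈ H := QuotientGroup.leftRel_apply.mp hxy
        have := integral_fiber_mul m f x ⟨x⁻¹ * y, hxy'⟩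
        simpa using this.symm)
      continuous_toFun := (continuous_integral_fiber m f).quotient_lift _
      hasCompactSupport' := by
        refine HasCompactSupport.intro
          (f.hasCompactSupport.image (QuotientGroup.continuous_mk (N := H))) fun z hz ↦ ?_
        obtain ⟨x, rfl⟩ := QuotientGroup.mk_surjective z
        change ∫ h : H, f (x * h) ∂m = 0
        refine integral_eq_zero_of_ae (.of_forall fun h ↦ ?_)
        refine image_eq_zero_of_notMem_tsupport fun hx ↦ hz ⟨_, hx, ?_⟩
        simp }
  map_add' f g := by
    ext z
    obtain ⟨x, rfl⟩ := QuotientGroup.mk_surjective z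
    exact integral_add (fiberRestrict H f x).integrable (fiberRestrict H g x).integrable
  map_smul' c f := by
    ext z
    obtain ⟨x, rfl⟩ := QuotientGroup.mk_surjective z
    exact integral_smul c (fun h : H ↦ f (x * h))

theorem fiberIntegral_mk (f : C_c(G, E)) (x : G) :
    fiberIntegral m f (x : G ⧸ H) = ∫ h : H, f (x * h) ∂m := rfl

theorem fiberIntegral_nonneg {f : C_c(G, ℝ)} (hf : 0 ≤ f) : 0 ≤ fiberIntegral m f := by
  intro z
  obtain ⟨x, rfl⟩ := QuotientGroup.mk_surjective z
  exact integral_nonneg fun h ↦ hf _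

/-- Take χ = 1 on C with compact support and ψ = 1 on a compact set covering supp χ; then φ = (χ /
ψ^♭) ψ works because χ / ψ^♭ is constant on cosets. -/
theorem exists_fiberIntegral_eq_one {C : Set (G ⧸ H)} (hC : IsCompact C) :
    ∃ φ : C_c(G, ℝ), 0 ≤ φ ∧ ∀ z ∈ C, fiberIntegral m φ z = 1 := by
  obtain ⟨χ, hχ1, -, hχc, hχ⟩ := exists_continuous_one_zero_of_isCompact hC isClosed_empty
    (Set.disjoint_empty C)
  obtain ⟨K, hK, hKC⟩ := QuotientGroup.exists_isCompact_subset_image_mk H hχc.isCompact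
  obtain ⟨ψ, hψ1, -, hψc, hψ⟩ := exists_continuous_one_zero_of_isCompact hK isClosed_empty
    (Set.disjoint_empty K)
  let ψ' : C_c(G, ℝ) := ⟨ψ, hψc⟩
  have hpos : ∀ z ∈ tsupport χ, 0 < fiberIntegral m ψ' z := by
    intro z hz
    obtain ⟨x, hx, rfl⟩ := hKC hz
    refine (fiberRestrict H ψ' x).continuous.integral_pos_of_hasCompactSupport_nonneg_nonzero
      (x := 1) (fiberRestrict H ψ' x).hasCompactSupport (fun h ↦ (hψ _).1) ?_
    have : ψ x = 1 := hψ1 hx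
    simp [ψ', this]
  -- Where χ = 0 the quotient is 0 whatever the denominator, so continuity matters only on supp χ,
  -- where ψ^♭ > 0.
  have hcont : Continuous fun z ↦ χ z / fiberIntegral m ψ' z := by
    refine continuous_of_tsupport fun z hz ↦ ?_
    refine χ.continuous.continuousAt.div (fiberIntegral m ψ').continuous.continuousAt
      (hpos z ?_).ne'
    exact closure_mono (fun w hw ↦ by
      rw [Function.mem_support] at hw ⊢
      exact fun h ↦ hw (by simp [h])) hz
  refine ⟨⟨⟨fun x ↦ χ x / fiberIntegral m ψ' x * ψ x, by
    exact (hcont.comp QuotientGroup.continuous_mk).mul ψ.continuous⟩, hψc.mul_left⟩, fun x ↦ ?_,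
    fun z hz ↦ ?_⟩
  · exact mul_nonneg (div_nonneg (hχ _).1
      (fiberIntegral_nonneg m (f := ψ') (fun y ↦ (hψ y).1) _)) (hψ x).1
  · have hz1 : χ z = 1 := hχ1 hz
    have hz2 := hpos z (subset_tsupport _ (by simp [hz1]))
    obtain ⟨x, rfl⟩ := QuotientGroup.mk_surjective z
    rw [fiberIntegral_mk] at hz2 ⊢
    simp only [CompactlySupportedContinuousMap.coe_mk, ContinuousMap.coe_mk,
      QuotientGroup.mk_mul_of_mem _ (Subtype.prop _), hz1]
    rw [integral_const_mul, fiberIntegral_mk]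
    exact one_div_mul_cancel hz2.ne'

/-- Multiply F by a φ with φ^♭ = 1 on supp F. Keeping φ ≥ 0 in the conclusion lets nonnegative F
have nonnegative lifts. -/
theorem exists_fiberIntegral_eq [CompleteSpace E] (F : C_c(G ⧸ H, E)) :
    ∃ (φ : C_c(G, ℝ)) (g : C_c(G, E)), 0 ≤ φ ∧ (∀ x : G, g x = φ x • F x) ∧
      fiberIntegral m g = F := by
  obtain ⟨φ, hφ0, hφ⟩ := exists_fiberIntegral_eq_one m F.hasCompactSupport.isCompact
  refine ⟨φ, ⟨⟨fun x ↦ φ x • F x, φ.continuous.smul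
    (F.continuous.comp QuotientGroup.continuous_mk)⟩, φ.hasCompactSupport.smul_right⟩, hφ0,
    fun x ↦ rfl, ?_⟩
  ext z
  by_cases hz : z ∈ tsupport F
  · have := hφ z hz
    obtain ⟨x, rfl⟩ := QuotientGroup.mk_surjective z
    rw [fiberIntegral_mk] at this ⊢
    simp only [CompactlySupportedContinuousMap.coe_mk, ContinuousMap.coe_mk,
      QuotientGroup.mk_mul_of_mem _ (Subtype.prop _), integral_smul_const, this, one_smul]
  · rw [image_eq_zero_of_notMem_tsupport hz]
    obtain ⟨x, rfl⟩ := QuotientGroup.mk_surjective z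
    rw [fiberIntegral_mk]
    simp [QuotientGroup.mk_mul_of_mem, image_eq_zero_of_notMem_tsupport hz]

end FiberIntegral

/-! ### Translates and invariance of Riesz measures -/

section Translate

variable {Γ X : Type*} [Group Γ] [MulAction Γ X] [TopologicalSpace X] [ContinuousConstSMul Γ X]
  {E : Type*} [NormedAddCommGroup E] [NormedSpace ℝ E]

/-- The translate `x ↦ F (g • x)` of a compactly supported continuous function. -/
def CompactlySupportedContinuousMap.compSMul (g : Γ) (F : C_c(X, E)) : C_c(X, E) :=
  F.comp (Homeomorph.smul g).toCocompactMap

omit [NormedSpace ℝ E] in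
@[simp] theorem CompactlySupportedContinuousMap.compSMul_apply (g : Γ) (F : C_c(X, E)) (x : X) :
    F.compSMul g x = F (g • x) := rfl

variable [MeasurableSpace X] [BorelSpace X]

theorem integral_compSMul {μ : Measure X} (hμ : SMulInvariantMeasure Γ X μ) (g : Γ)
    (F : C_c(X, E)) : ∫ x, F.compSMul g x ∂μ = ∫ x, F x ∂μ :=
  integral_smul_eq_self (fun x ↦ F x)

theorem smulInvariantMeasure_rieszMeasure [T2Space X] [LocallyCompactSpace X]
    (Λ : C_c(X, ℝ) →ₚ[ℝ] ℝ) (hΛ : ∀ (g : Γ) (F : C_c(X, ℝ)), Λ (F.compSMul g) = Λ F) :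
    SMulInvariantMeasure Γ X (RealRMK.rieszMeasure Λ) := by
  refine ⟨fun g s hs ↦ ?_⟩
  rw [← Measure.map_apply (measurable_const_smul g) hs]
  congr 1
  have : ((RealRMK.rieszMeasure Λ).map (g • ·)).Regular := Measure.Regular.map (Homeomorph.smul g)
  refine Measure.ext_of_integral_eq_on_compactlySupported fun F ↦ ?_
  rw [integral_map (by fun_prop) (by fun_prop), RealRMK.integral_rieszMeasure, ← hΛ g,
    ← RealRMK.integral_rieszMeasure]
  rfl

end Translate

/-- Composition of a compactly supported continuous function with a continuous linear map. -/
noncomputable def CompactlySupportedContinuousMap.postcomp {X E F : Type*} [TopologicalSpace X]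
    [NormedAddCommGroup E] [NormedSpace ℝ E] [NormedAddCommGroup F] [NormedSpace ℝ F]
    (L : E →L[ℝ] F) (f : C_c(X, E)) : C_c(X, F) :=
  f.compLeft L

theorem CompactlySupportedContinuousMap.postcomp_apply {X E F : Type*} [TopologicalSpace X]
    [NormedAddCommGroup E] [NormedSpace ℝ E] [NormedAddCommGroup F] [NormedSpace ℝ F]
    (L : E →L[ℝ] F) (f : C_c(X, E)) (x : X) : f.postcomp L x = L (f x) :=
  compLeft_apply (map_zero L) f x

/-! ### Weil's formula, existence and uniqueness on G/H -/

section InvariantMeasure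

open Topology Pointwise Measure

variable {G : Type*} [Group G] [TopologicalSpace G] [IsTopologicalGroup G] [LocallyCompactSpace G]
  [MeasurableSpace G] [BorelSpace G] {H : Subgroup G} [IsClosed (H : Set G)]
  (m : Measure H) [m.IsHaarMeasure] (lam : Measure G) [lam.IsHaarMeasure]
  {E : Type*} [NormedAddCommGroup E] [NormedSpace ℝ E]

theorem fiberIntegral_compSMul (g : G) (f : C_c(G, E)) :
    fiberIntegral m (f.compSMul g) = (fiberIntegral m f).compSMul g := by
  ext z
  obtain ⟨x, rfl⟩ := QuotientGroup.mk_surjective z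
  simp only [CompactlySupportedContinuousMap.compSMul_apply, MulAction.Quotient.smul_coe,
    fiberIntegral_mk, smul_eq_mul, mul_assoc]

theorem fiberIntegral_postcomp [CompleteSpace E] {F : Type*} [NormedAddCommGroup F]
    [NormedSpace ℝ F] [CompleteSpace F] (L : E →L[ℝ] F) (f : C_c(G, E)) (z : G ⧸ H) :
    fiberIntegral m (f.postcomp L) z = L (fiberIntegral m f z) := by
  obtain ⟨x, rfl⟩ := QuotientGroup.mk_surjective z
  simp only [fiberIntegral_mk, CompactlySupportedContinuousMap.postcomp_apply]
  exact L.integral_comp_comm (fiberRestrict H f x).integrable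

section Symmetry

variable (hΔ : ∀ h : H, modularCharacter (h : G) = modularCharacter h)
include hΔ

/-- After Fubini, replacing x by xh⁻¹ produces Δ_G(h) = Δ_H(h), which is exactly the factor absorbed
by h ↦ h⁻¹ in H. Compact supports make Fubini valid without σ-finiteness. -/
theorem integral_mul_fiberIntegral_comm (f φ : C_c(G, ℝ)) :
    ∫ x : G, f x * fiberIntegral m φ x ∂lam = ∫ x : G, φ x * fiberIntegral m f x ∂lam := by
  -- This compact set bounds h in both Fubini swaps: x, xh and xh⁻¹, x are the respective pairs of
  -- points in the supports.
  have hK : IsCompact ((↑) ⁻¹' ((tsupport f)⁻¹ * tsupport φ) : Set H) :=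
    Subgroup.isClosedEmbedding_subtype_of_isClosed.isCompact_preimage
      (f.hasCompactSupport.isCompact.inv.mul φ.hasCompactSupport)
  have hcont : Continuous fun h : H ↦ (modularCharacter h : ℝ) := continuous_modularCharacter
  calc ∫ x : G, f x * fiberIntegral m φ x ∂lam
    _ = ∫ x : G, ∫ h : H, f x * φ (x * h) ∂m ∂lam := by
      simp only [fiberIntegral_mk, integral_const_mul]
    _ = ∫ h : H, ∫ x : G, f x * φ (x * h) ∂lam ∂m := by
      refine integral_integral_swap_of_hasCompactSupport (by fun_prop) ?_
      refine HasCompactSupport.intro (f.hasCompactSupport.isCompact.prod hK) fun ⟨x, h⟩ hx ↦ ?_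
      contrapose! hx
      have hx1 := subset_tsupport _ (left_ne_zero_of_mul hx)
      exact ⟨hx1, x⁻¹, Set.inv_mem_inv.mpr hx1, x * h,
        subset_tsupport _ (right_ne_zero_of_mul hx), by simp⟩
    _ = ∫ h : H, ∫ x : G, φ x * (modularCharacter h * f (x * (h : G)⁻¹)) ∂lam ∂m := by
      congr 1 with h
      have := integral_mul_right_eq_modularCharacter_mul lam
        (f := fun x ↦ f (x * (h : G)⁻¹) * φ x) (by fun_prop) φ.hasCompactSupport.mul_left h
      simp only [mul_inv_cancel_right] at this
      rw [this, hΔ, ← integral_const_mul]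
      congr 1 with x
      ring
    _ = ∫ x : G, ∫ h : H, φ x * (modularCharacter h * f (x * (h : G)⁻¹)) ∂m ∂lam := by
      refine (integral_integral_swap_of_hasCompactSupport ?_ ?_).symm
      · exact (φ.continuous.comp continuous_fst).mul ((hcont.comp continuous_snd).mul
          (f.continuous.comp (by fun_prop)))
      · refine HasCompactSupport.intro (φ.hasCompactSupport.isCompact.prod hK) fun ⟨x, h⟩ hx ↦ ?_
        contrapose! hx
        have hx1 := subset_tsupport _ (left_ne_zero_of_mul hx)
        have hx2 := subset_tsupport _ (right_ne_zero_of_mul (right_ne_zero_of_mul hx))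
        exact ⟨hx1, _, Set.inv_mem_inv.mpr hx2, x, hx1, by simp⟩
    _ = ∫ x : G, φ x * fiberIntegral m f x ∂lam := by
      congr 1 with x
      rw [integral_const_mul, fiberIntegral_mk,
        ← integral_modularCharacter_mul_comp_inv m (f := fun h : H ↦ f (x * h)) (by fun_prop)
          (fiberRestrict H f x).hasCompactSupport]
      rfl

/-- With φ^♭ = 1 on the image of supp f, ∫ f = ∫ f φ^♭ = ∫ φ f^♭ = 0. -/
theorem integral_eq_zero_of_fiberIntegral_eq_zero {f : C_c(G, ℝ)} (hf : fiberIntegral m f = 0) :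
    ∫ x, f x ∂lam = 0 := by
  obtain ⟨φ, -, hφ⟩ := exists_fiberIntegral_eq_one m (H := H)
    (f.hasCompactSupport.isCompact.image (QuotientGroup.continuous_mk (N := H)))
  have := integral_mul_fiberIntegral_comm m lam hΔ f φ
  simp only [hf, CompactlySupportedContinuousMap.zero_apply, mul_zero, integral_zero] at this
  rw [← this]
  congr 1 with x
  by_cases hx : x ∈ tsupport f
  · rw [hφ _ ⟨x, hx, rfl⟩, mul_one]
  · rw [image_eq_zero_of_notMem_tsupport hx, zero_mul]

theorem integral_eq_of_fiberIntegral_eq {f g : C_c(G, ℝ)}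
    (hfg : fiberIntegral m f = fiberIntegral m g) : ∫ x, f x ∂lam = ∫ x, g x ∂lam := by
  have := integral_eq_zero_of_fiberIntegral_eq_zero m lam hΔ (f := f - g)
    (by rw [map_sub, hfg, sub_self])
  simp only [CompactlySupportedContinuousMap.coe_sub, Pi.sub_apply] at this
  rwa [integral_sub f.integrable g.integrable, sub_eq_zero] at this

theorem exists_isInvariantRadonMeasure_quotient [T2Space G] [MeasurableSpace (G ⧸ H)]
    [BorelSpace (G ⧸ H)] : ∃ ρ : Measure (G ⧸ H), IsInvariantRadonMeasure G ρ := by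
  choose lift hlift0 hlift using fun F : C_c(G ⧸ H, ℝ) ↦
    (show ∃ g : C_c(G, ℝ), (0 ≤ F → 0 ≤ g) ∧ fiberIntegral (haar : Measure H) g = F by
      obtain ⟨φ, g, hφ, hg, hgF⟩ := exists_fiberIntegral_eq (haar : Measure H) F
      exact ⟨g, fun hF x ↦ (mul_nonneg (hφ x) (hF x)).trans_eq (hg x).symm, hgF⟩)
  -- The chosen lift need not be linear in F; its integral is, since it does not depend on the lift.
  have key {f : C_c(G, ℝ)} {F : C_c(G ⧸ H, ℝ)} (h : fiberIntegral (haar : Measure H) f = F) :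
      ∫ x, lift F x ∂(haar : Measure G) = ∫ x, f x ∂haar :=
    integral_eq_of_fiberIntegral_eq haar haar hΔ ((hlift F).trans h.symm)
  let Λ₀ : C_c(G ⧸ H, ℝ) →ₗ[ℝ] ℝ :=
    { toFun F := ∫ x, lift F x ∂haar
      map_add' F F' := by
        rw [key (f := lift F + lift F') (by rw [map_add, hlift, hlift])]
        exact integral_add (lift F).integrable (lift F').integrable
      map_smul' c F := by
        rw [key (f := c • lift F) (by rw [map_smul, hlift])]
        exact integral_smul c (fun x ↦ lift F x) }
  let Λ : C_c(G ⧸ H, ℝ) →ₚ[ℝ] ℝ := ⟨Λ₀, fun F F' hF ↦ by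
    change Λ₀ F ≤ Λ₀ F'
    rw [← sub_nonneg, ← map_sub]
    exact integral_nonneg (hlift0 _ fun z ↦ sub_nonneg.mpr (hF z))⟩
  have hΛ (f : C_c(G, ℝ)) : Λ (fiberIntegral haar f) = ∫ x, f x ∂haar := key rfl
  refine ⟨RealRMK.rieszMeasure Λ, RealRMK.regular_rieszMeasure Λ,
    smulInvariantMeasure_rieszMeasure Λ fun g F ↦ ?_, fun h0 ↦ ?_⟩
  · rw [← hlift F, ← fiberIntegral_compSMul, hΛ, hΛ]
    exact integral_mul_left_eq_self (fun x ↦ lift F x) g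
  · obtain ⟨f, -, hf⟩ := exists_integral_pos (haar : Measure G)
    rw [← hΛ, ← RealRMK.integral_rieszMeasure, h0, integral_zero_measure] at hf
    exact hf.false

end Symmetry

variable [T2Space G] [MeasurableSpace (G ⧸ H)] [BorelSpace (G ⧸ H)] {μ : Measure (G ⧸ H)}

theorem IsInvariantRadonMeasure.exists_integral_fiberIntegral_eq
    (hμ : IsInvariantRadonMeasure G μ) :
    ∃ c : ℝ≥0, 0 < c ∧ ∀ f : C_c(G, ℝ),
      ∫ z, fiberIntegral m f z ∂μ = c * ∫ x, f x ∂lam := by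
  have := hμ.regular
  let Λ : C_c(G, ℝ) →ₚ[ℝ] ℝ :=
    ⟨{ toFun f := ∫ z, fiberIntegral m f z ∂μ
       map_add' f f' := by
        rw [map_add]
        exact integral_add (fiberIntegral m f).integrable (fiberIntegral m f').integrable
       map_smul' c f := by
        rw [map_smul]
        exact integral_smul c (fun z ↦ fiberIntegral m f z) }, fun f f' hf ↦ by
      refine integral_mono (fiberIntegral m f).integrable (fiberIntegral m f').integrable fun z ↦ ?_
      have := fiberIntegral_nonneg m (f := f' - f) (fun x ↦ sub_nonneg.mpr (hf x)) z
      rw [map_sub] at this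
      exact sub_nonneg.mp this⟩
  have hΛ (f : C_c(G, ℝ)) : ∫ x, f x ∂(RealRMK.rieszMeasure Λ) = ∫ z, fiberIntegral m f z ∂μ :=
    RealRMK.integral_rieszMeasure Λ f
  have hinv : SMulInvariantMeasure G G (RealRMK.rieszMeasure Λ) :=
    smulInvariantMeasure_rieszMeasure Λ fun g f ↦ by
      change ∫ z, fiberIntegral m (f.compSMul g) z ∂μ = ∫ z, fiberIntegral m f z ∂μ
      rw [fiberIntegral_compSMul, integral_compSMul hμ.invariant]
  have : (RealRMK.rieszMeasure Λ).IsMulLeftInvariant :=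
    ⟨fun g ↦ MeasureTheory.map_smul (c := g) (μ := RealRMK.rieszMeasure Λ)⟩
  have main (f : C_c(G, ℝ)) : ∫ z, fiberIntegral m f z ∂μ =
      haarScalarFactor (RealRMK.rieszMeasure Λ) lam * ∫ x, f x ∂lam := by
    rw [← hΛ, integral_isMulLeftInvariant_eq_smul_of_hasCompactSupport _ lam (map_continuous f)
      f.hasCompactSupport, integral_smul_nnreal_measure]
    rfl
  -- A zero factor would make μ vanish on all f^♭, that is, on all of C_c(G/H).
  refine ⟨_, pos_iff_ne_zero.mpr fun h0 ↦ hμ.ne_zero ?_, main⟩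
  refine ext_of_integral_eq_on_compactlySupported fun F ↦ ?_
  obtain ⟨-, f, -, -, rfl⟩ := exists_fiberIntegral_eq m F
  rw [main, h0, integral_zero_measure, NNReal.coe_zero, zero_mul]

/-- **Weil's integration formula**. -/
theorem IsInvariantRadonMeasure.exists_integral_fiberIntegral_eq_complex
    (hμ : IsInvariantRadonMeasure G μ) :
    ∃ c : ℝ≥0, 0 < c ∧ ∀ f : C_c(G, ℂ),
      ∫ z, fiberIntegral m f z ∂μ = c * ∫ x, f x ∂lam := by
  have := hμ.regular
  obtain ⟨c, hc, h⟩ := hμ.exists_integral_fiberIntegral_eq m lam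
  have key (L : ℂ →L[ℝ] ℝ) (f : C_c(G, ℂ)) :
      L (∫ z, fiberIntegral m f z ∂μ) = c * L (∫ x, f x ∂lam) := by
    rw [← L.integral_comp_comm (fiberIntegral m f).integrable, ← L.integral_comp_comm f.integrable]
    simp only [← fiberIntegral_postcomp, ← CompactlySupportedContinuousMap.postcomp_apply L f, h]
  exact ⟨c, hc, fun f ↦ Complex.ext (by simpa using key Complex.reCLM f)
    (by simpa using key Complex.imCLM f)⟩

theorem IsInvariantRadonMeasure.exists_eq_smul {μ' : Measure (G ⧸ H)}
    (hμ : IsInvariantRadonMeasure G μ) (hμ' : IsInvariantRadonMeasure G μ') :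
    ∃ c : ℝ≥0, 0 < c ∧ μ' = c • μ := by
  have := hμ.regular
  have := hμ'.regular
  obtain ⟨c, hc, h⟩ := hμ.exists_integral_fiberIntegral_eq haar haar
  obtain ⟨c', hc', h'⟩ := hμ'.exists_integral_fiberIntegral_eq haar haar
  refine ⟨c' / c, div_pos hc' hc, ?_⟩
  have : ((c' / c) • μ).Regular := Regular.smul_nnreal _
  refine ext_of_integral_eq_on_compactlySupported fun F ↦ ?_
  obtain ⟨-, f, -, -, rfl⟩ := exists_fiberIntegral_eq (haar : Measure H) F
  rw [h', integral_smul_nnreal_measure, h, NNReal.smul_def, smul_eq_mul, NNReal.coe_div]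
  have := (NNReal.coe_pos.mpr hc).ne'
  field_simp

/-- Test Weil's formula on f'(x) = f(xh): the integral over G scales by Δ_G(h), while f'^♭ = Δ_H(h)
f^♭. -/
theorem IsInvariantRadonMeasure.modularCharacter_eq (hμ : IsInvariantRadonMeasure G μ) (h : H) :
    modularCharacter (h : G) = modularCharacter h := by
  obtain ⟨c, hc, hint⟩ := hμ.exists_integral_fiberIntegral_eq haar haar
  obtain ⟨f, -, hf⟩ := exists_integral_pos (haar : Measure G)
  let f' : C_c(G, ℝ) := f.comp (Homeomorph.mulRight (h : G)).toCocompactMap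
  have hf' : fiberIntegral (haar : Measure H) f' =
      (modularCharacter h : ℝ) • fiberIntegral (haar : Measure H) f := by
    ext z
    obtain ⟨x, rfl⟩ := QuotientGroup.mk_surjective z
    rw [CompactlySupportedContinuousMap.smul_apply, fiberIntegral_mk, fiberIntegral_mk,
      smul_eq_mul, ← integral_mul_right_eq_modularCharacter_mul haar (f := fun k : H ↦ f (x * k))
        (by fun_prop) (fiberRestrict H f x).hasCompactSupport]
    simp [f', mul_assoc]
  have h1 : ∫ x, f' x ∂haar = modularCharacter (h : G) * ∫ x, f x ∂haar :=
    integral_mul_right_eq_modularCharacter_mul haar f.continuous f.hasCompactSupport h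
  have h2 := hint f'
  rw [h1, hf'] at h2
  simp only [CompactlySupportedContinuousMap.smul_apply, smul_eq_mul, integral_const_mul,
    hint] at h2
  have := (NNReal.coe_pos.mpr hc).ne'
  refine NNReal.coe_injective (mul_right_cancel₀ (mul_ne_zero this hf.ne') ?_)
  linarith

end InvariantMeasure

/-! ### The transform on fiber integrals -/

section SubgroupOf

open Measure

variable {G : Type*} [Group G] [TopologicalSpace G] {H L : Subgroup G}

/-- `Subgroup.subgroupOfEquivOfLe` as an isomorphism of topological groups. -/
def Subgroup.subgroupOfContinuousMulEquiv (hLH : L ≤ H) : L.subgroupOf H ≃ₜ* L where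
  __ := Subgroup.subgroupOfEquivOfLe hLH
  continuous_toFun := Continuous.subtype_mk
    (continuous_subtype_val.comp continuous_subtype_val) fun x ↦ x.2
  continuous_invFun := Continuous.subtype_mk
    (Continuous.subtype_mk continuous_subtype_val fun x ↦ hLH x.2) fun x ↦ x.2

theorem Subgroup.isClosed_subgroupOf [hL : IsClosed (L : Set G)] :
    IsClosed (L.subgroupOf H : Set H) :=
  hL.preimage continuous_subtype_val

variable [IsTopologicalGroup G] [LocallyCompactSpace G] [T2Space G] [MeasurableSpace G]
  [BorelSpace G] [IsClosed (H : Set G)] [IsClosed (L : Set G)]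
  [MeasurableSpace (H ⧸ L.subgroupOf H)] [BorelSpace (H ⧸ L.subgroupOf H)]

/-- The transform `R_{L,H}` turns the integration of `C_c(G)` along `L` into the integration
along `H`, up to a constant factor. -/
theorem exists_radonTransform_fiberIntegral_eq (hLH : L ≤ H) (mH : Measure H) [mH.IsHaarMeasure]
    (mL : Measure L) [mL.IsHaarMeasure] (η : Measure (H ⧸ L.subgroupOf H))
    (hη : IsInvariantRadonMeasure H η) :
    ∃ c : ℝ≥0, 0 < c ∧ ∀ g : C_c(G, ℂ),
      radonTransform η hη.invariant (fiberIntegral mL g) =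
        fun z ↦ (c : ℂ) * fiberIntegral mH g z := by
  have : IsClosed (L.subgroupOf H : Set H) := Subgroup.isClosed_subgroupOf
  let e := Subgroup.subgroupOfContinuousMulEquiv hLH
  let m : Measure (L.subgroupOf H) := map e.symm mL
  obtain ⟨c, hc, h⟩ := hη.exists_integral_fiberIntegral_eq_complex m mH
  refine ⟨c, hc, fun g ↦ funext fun z ↦ ?_⟩
  obtain ⟨x, rfl⟩ := QuotientGroup.mk_surjective z
  rw [radonTransform_mk, fiberIntegral_mk]
  -- Weil's formula on H/L, applied to k ↦ g(xk).
  refine Eq.trans ?_ (h (fiberRestrict H g x))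
  congr 1 with t
  obtain ⟨k, rfl⟩ := QuotientGroup.mk_surjective t
  rw [cosetTranslate_mk, fiberIntegral_mk, fiberIntegral_mk]
  refine Eq.trans ?_ (e.symm.toHomeomorph.measurableEmbedding.integral_map _).symm
  congr 1 with l
  rw [fiberRestrict_apply, Subgroup.coe_mul, ← mul_assoc]
  rfl

end SubgroupOf

/-! ### The theorem for L ≤ H ≤ G -/

theorem theorem3p5 {G : Type*} [Group G] [TopologicalSpace G] [IsTopologicalGroup G]
    [LocallyCompactSpace G] [T2Space G]
    (H L : Subgroup G) [IsClosed (H : Set G)] [IsClosed (L : Set G)] (hLH : L ≤ H)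
    [MeasurableSpace (G ⧸ H)] [BorelSpace (G ⧸ H)]
    [MeasurableSpace (G ⧸ L)] [BorelSpace (G ⧸ L)]
    [MeasurableSpace (H ⧸ L.subgroupOf H)] [BorelSpace (H ⧸ L.subgroupOf H)]
    -- `Δ_H` restricted to `L` equals `Δ_L`
    (hΔ : ∀ l : L, Measure.modularCharacter (Subgroup.inclusion hLH l) =
      Measure.modularCharacter l) :
    -- existence of invariant measures on `G / H` and `G / L`
    ((∃ (μ : Measure (G ⧸ H)) (ν : Measure (G ⧸ L)),
        IsInvariantRadonMeasure G μ ∧ IsInvariantRadonMeasure G ν) ↔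
      ∀ h : H, Measure.modularCharacter (h : G) = Measure.modularCharacter h) ∧
    -- uniqueness up to a positive constant
    (∀ μ μ' : Measure (G ⧸ H), IsInvariantRadonMeasure G μ → IsInvariantRadonMeasure G μ' →
      ∃ c : ℝ≥0, 0 < c ∧ μ' = c • μ) ∧
    (∀ ν ν' : Measure (G ⧸ L), IsInvariantRadonMeasure G ν → IsInvariantRadonMeasure G ν' →
      ∃ c : ℝ≥0, 0 < c ∧ ν' = c • ν) ∧
    -- existence of an invariant measure `η` on `H / L`
    (∃ η : Measure (H ⧸ L.subgroupOf H), IsInvariantRadonMeasure H η) ∧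
    -- for every such `η`, the transform maps `C_c(G / L)` to `C_c(G / H)`, and the integral
    -- formula holds after normalization of `ν`
    (∀ (η : Measure (H ⧸ L.subgroupOf H)) (hη : IsInvariantRadonMeasure H η),
      (∀ f : C_c(G ⧸ L, ℂ), Continuous (radonTransform η hη.invariant f) ∧
        HasCompactSupport (radonTransform η hη.invariant f)) ∧
      ∀ (μ : Measure (G ⧸ H)) (ν : Measure (G ⧸ L)),
        IsInvariantRadonMeasure G μ → IsInvariantRadonMeasure G ν →
        ∃ c : ℝ≥0, 0 < c ∧ ∀ f : C_c(G ⧸ L, ℂ),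
          ∫ y, f y ∂(c • ν) = ∫ z, radonTransform η hη.invariant f z ∂μ ∧
          ∫ z, radonTransform η hη.invariant f z ∂μ =
            ∫ z : G ⧸ H, ∫ t, f (cosetTranslate H L z.out t) ∂η ∂μ) := by
  borelize G
  have hL : IsClosed (L.subgroupOf H : Set H) := Subgroup.isClosed_subgroupOf
  refine ⟨⟨fun ⟨μ, ν, hμ, _⟩ h ↦ hμ.modularCharacter_eq h, fun h ↦ ?_⟩,
    fun μ μ' hμ hμ' ↦ hμ.exists_eq_smul hμ', fun ν ν' hν hν' ↦ hν.exists_eq_smul hν', ?_,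
    fun η hη ↦ ⟨fun f ↦ ?_, fun μ ν hμ hν ↦ ?_⟩⟩
  · obtain ⟨μ, hμ⟩ := exists_isInvariantRadonMeasure_quotient (G := G) (H := H) h
    obtain ⟨ν, hν⟩ := exists_isInvariantRadonMeasure_quotient (G := G) (H := L)
      fun l ↦ (h (Subgroup.inclusion hLH l)).trans (hΔ l)
    exact ⟨μ, ν, hμ, hν⟩
  · refine exists_isInvariantRadonMeasure_quotient (G := H) (H := L.subgroupOf H) fun l ↦ ?_
    rw [← modularCharacter_continuousMulEquiv (Subgroup.subgroupOfContinuousMulEquiv hLH) l, ← hΔ]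
    rfl
  · obtain ⟨c, -, hc⟩ := exists_radonTransform_fiberIntegral_eq hLH Measure.haar Measure.haar η hη
    obtain ⟨-, g, -, -, rfl⟩ := exists_fiberIntegral_eq (Measure.haar : Measure L) f
    rw [hc]
    exact ⟨continuous_const.mul (map_continuous _),
      (fiberIntegral (Measure.haar : Measure H) g).hasCompactSupport.mul_left⟩
  · obtain ⟨a, ha, hηa⟩ := exists_radonTransform_fiberIntegral_eq hLH Measure.haar Measure.haar η hη
    obtain ⟨b, hb, hμb⟩ := hμ.exists_integral_fiberIntegral_eq_complex Measure.haar Measure.haar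
    obtain ⟨d, hd, hνd⟩ := hν.exists_integral_fiberIntegral_eq_complex Measure.haar Measure.haar
    -- For f the fiber integral of g along L, ∫ R f dμ = ab ∫ g and ∫ f dν = d ∫ g.
    refine ⟨a * b / d, by positivity, fun f ↦ ⟨?_, ?_⟩⟩
    · obtain ⟨-, g, -, -, rfl⟩ := exists_fiberIntegral_eq (Measure.haar : Measure L) f
      rw [hηa, integral_const_mul, hμb, integral_smul_nnreal_measure, hνd, NNReal.smul_def,
        Complex.real_smul]
      have : (d : ℂ) ≠ 0 := by exact_mod_cast hd.ne'
      push_cast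
      field_simp
    · congr 1 with z
      conv_lhs => rw [← QuotientGroup.out_eq' z]
      rfl
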